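/- For polynomials $f,g\in\mathbb Q[t]$, a prime $p$ and $m\ge 1$, write $f\equiv g\pmod{p^m}$ if every coefficient of $f-g$ has the form $p^m a$ with $a$ a rational number whose reduced denominator is not divisible by $p$. Define the Lucas sequences by $u_0(x,y)=0$, $u_1(x,y)=1$, $u_n(x,y)=x\,u_{n-1}(x,y)-y\,u_{n-2}(x,y)$ and $v_0(x,y)=2$, $v_1(x,y)=x$, $v_n(x,y)=x\,v_{n-1}(x,y)-y\,v_{n-2}(x,y)$ for $n>1$, and put $u_n(x)=u_n(x,1)$, $v_n(x)=v_n(x,1)$. Theorem. For every prime $p>3$ the following polynomial congruences in $\mathbb Q[t]$ hold: $$\sum_{k=0}^{p-1}\binom{2k}{k}t^{p-1-k}\equiv 2u_p(t,t)-u_p(2-t)-2p^2\sum_{k=1}^{p-1}\frac{u_k(2-t)+u_k(t,t)}{k^2}\pmod{p^3},$$ $$\sum_{k=1}^{p-1}\frac{\binom{2k}{k}}{k}\,t^{p-k}\equiv\frac{3t^p+2-v_p(2-t)-4v_p(t,t)}{p}\pmod{p^2},$$ $$\frac12\sum_{k=1}^{p-1}\frac{\binom{2k}{k}}{k^2}\,t^{p-k}\equiv\frac{v_p(2-t)+2v_p(t,t)-t^p-2}{p^2}+\sum_{k=1}^{p-1}\frac{v_k(2-t)}{k^2}\pmod{p}.$$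 -/

import Mathlib

open Polynomial

/-- The Lucas sequence `u_n(x, y)`: `u_0 = 0`, `u_1 = 1`, `u_n = x u_{n-1} - y u_{n-2}`. -/
def lucasU {R : Type*} [CommRing R] (x y : R) : ℕ → R
  | 0 => 0
  | 1 => 1
  | n + 2 => x * lucasU x y (n + 1) - y * lucasU x y n

/-- The Lucas sequence `v_n(x, y)`: `v_0 = 2`, `v_1 = x`, `v_n = x v_{n-1} - y v_{n-2}`. -/
def lucasV {R : Type*} [CommRing R] (x y : R) : ℕ → R
  | 0 => 2
  | 1 => x
  | n + 2 => x * lucasV x y (n + 1) - y * lucasV x y n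

/-- The one-variable Lucas sequence `u_n(x) = u_n(x, 1)`. -/
abbrev lucasU₁ {R : Type*} [CommRing R] (x : R) (n : ℕ) : R := lucasU x 1 n

/-- The one-variable Lucas sequence `v_n(x) = v_n(x, 1)`. -/
abbrev lucasV₁ {R : Type*} [CommRing R] (x : R) (n : ℕ) : R := lucasV x 1 n

/-- A rational number is `p`-integral if `p` does not divide its reduced denominator. -/
def PIntegral (p : ℕ) (q : ℚ) : Prop := ¬ p ∣ q.den

/-- `f ≡ g (mod p ^ m)` for polynomials with rational coefficients: every coefficient of `f - g`
is `p ^ m` times a `p`-integral rational number. -/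
def PolyModEq (p m : ℕ) (f g : ℚ[X]) : Prop :=
  ∀ n : ℕ, ∃ a : ℚ, PIntegral p a ∧ (f - g).coeff n = (p : ℚ) ^ m * a

/-! Substituting `a + 1/a = t - 2` turns `u_j(t - 2)` into `(a^j - a^(-j)) / (a - a^(-1))`, and the
roots of `z^2 - t z + t` become `1 + a` and `1 + 1/a`. Hence both `u_p(t, t)` and the central
binomial sum expand in the polynomials `u_{j+1}(2 - t)`, with coefficients `(-1)^j C(p, j+1)` and
`(-1)^j C(2p, p+1+j)` (`lucasU_self_eq_sum_succ`, `sum_centralBinom_mul_pow'`). Modulo `p^3` these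
coefficients are explicit in `1/(j+1)` and harmonic numbers. In the sum minus `2 u_p(t, t)` the
terms of order `p` cancel. The remaining harmonic part is `∑ u_k(t, t)/k^2` modulo `p`
(`exists_sum_lucasU_self_div_sq_eq`), which gives the first congruence.

The other two follow by integration. The operator `θ - p j`, where `θ = X d/dX` and `j` is an
integer, multiplies the coefficient of `X^n` by `n - p j`, a `p`-unit for `0 < n < p`. So
divisibility by `p^m` can be tested after applying it, once the coefficients at `0` and `p` are
checked (`exists_eq_pow_mul_of_X_mul_derivative`). With `j = 1` it sends the sum weighted by `1/k^2`
to minus the one weighted by `1/k`, and that one to minus the unweighted sum. The link between the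
two sides is `2 v_p(t, t) + v_p(2 - t) ≡ t^p + 2` modulo `p^2` (`exists_lucasV_relation`). -/

/-- The subring of `p`-integral rational numbers. -/
def pIntegralSubring (p : ℕ) [hp : Fact p.Prime] : Subring ℚ where
  carrier := {q | PIntegral p q}
  mul_mem' {a b} ha hb h :=
    ((hp.out.dvd_mul).1 (h.trans (Rat.mul_den_dvd a b))).elim ha hb
  one_mem' h := hp.out.one_lt.ne' (Nat.dvd_one.1 (by simpa using h))
  add_mem' {a b} ha hb h :=
    ((hp.out.dvd_mul).1 (h.trans (Rat.add_den_dvd a b))).elim ha hb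
  zero_mem' h := hp.out.one_lt.ne' (Nat.dvd_one.1 (by simpa using h))
  neg_mem' {a} ha h := ha (by simpa using h)

/-- The subring of rational polynomials all of whose coefficients are `p`-integral. -/
def pIntegralPoly (p : ℕ) [Fact p.Prime] : Subring ℚ[X] where
  carrier := {f | ∀ n, f.coeff n ∈ pIntegralSubring p}
  mul_mem' {f g} hf hg n := by
    rw [coeff_mul]
    exact Subring.sum_mem _ fun i _ => Subring.mul_mem _ (hf _) (hg _)
  one_mem' n := by
    rw [coeff_one]
    split_ifs
    exacts [Subring.one_mem _, Subring.zero_mem _]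
  add_mem' {f g} hf hg n := by
    rw [coeff_add]
    exact Subring.add_mem _ (hf n) (hg n)
  zero_mem' n := by
    rw [coeff_zero]
    exact Subring.zero_mem _
  neg_mem' {f} hf n := by
    rw [coeff_neg]
    exact Subring.neg_mem _ (hf n)

/-! ### Closure properties of `p`-integral numbers and polynomials -/

section Integrality

variable {p : ℕ} [hp : Fact p.Prime]

theorem inv_natCast_mem_pIntegralSubring {n : ℕ} (h : ¬ p ∣ n) :
    (n : ℚ)⁻¹ ∈ pIntegralSubring p := by
  show ¬ p ∣ _
  rwa [Rat.inv_natCast_den_of_pos (Nat.pos_of_ne_zero (by rintro rfl; exact h (dvd_zero p)))]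

theorem inv_succ_mem_pIntegralSubring {j : ℕ} (h : j + 1 < p) :
    ((j : ℚ) + 1)⁻¹ ∈ pIntegralSubring p := by
  have := inv_natCast_mem_pIntegralSubring (p := p) (n := j + 1)
    (Nat.not_dvd_of_pos_of_lt (Nat.succ_pos j) h)
  exact_mod_cast this

theorem harmonic_mem_pIntegralSubring {n : ℕ} (h : n < p) :
    harmonic n ∈ pIntegralSubring p := by
  refine Subring.sum_mem _ fun i hi => ?_
  rw [Finset.mem_range] at hi
  exact_mod_cast inv_succ_mem_pIntegralSubring (by omega : i + 1 < p)

theorem inv_intCast_mem_pIntegralSubring {n : ℤ} (h : ¬ (p : ℤ) ∣ n) :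
    (n : ℚ)⁻¹ ∈ pIntegralSubring p := by
  have h' := inv_natCast_mem_pIntegralSubring (p := p) (n := n.natAbs)
    fun hd => h (Int.natCast_dvd.2 hd)
  rcases Int.natAbs_eq n with e | e
  · rw [e, Int.cast_natCast]
    exact h'
  · rw [e, Int.cast_neg, Int.cast_natCast, inv_neg]
    exact neg_mem h'

theorem C_mem_pIntegralPoly {a : ℚ} (ha : a ∈ pIntegralSubring p) : C a ∈ pIntegralPoly p := by
  intro n
  rw [coeff_C]
  split_ifs
  exacts [ha, Subring.zero_mem _]

theorem X_mem_pIntegralPoly : X ∈ pIntegralPoly p := by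
  intro n
  rw [coeff_X]
  split_ifs
  exacts [Subring.one_mem _, Subring.zero_mem _]

theorem lucasU_mem {R : Type*} [CommRing R] {S : Subring R} {x y : R} (hx : x ∈ S) (hy : y ∈ S) :
    ∀ n, lucasU x y n ∈ S
  | 0 => S.zero_mem
  | 1 => S.one_mem
  | n + 2 => S.sub_mem (S.mul_mem hx (lucasU_mem hx hy (n + 1))) (S.mul_mem hy (lucasU_mem hx hy n))

theorem lucasV_mem {R : Type*} [CommRing R] {S : Subring R} {x y : R} (hx : x ∈ S) (hy : y ∈ S) :
    ∀ n, lucasV x y n ∈ S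
  | 0 => ofNat_mem S 2
  | 1 => hx
  | n + 2 => S.sub_mem (S.mul_mem hx (lucasV_mem hx hy (n + 1))) (S.mul_mem hy (lucasV_mem hx hy n))

theorem polyModEq_of_sub_eq {m : ℕ} {f g h : ℚ[X]} (hh : h ∈ pIntegralPoly p)
    (e : f - g = (p : ℚ[X]) ^ m * h) : PolyModEq p m f g := by
  intro n
  refine ⟨h.coeff n, hh n, ?_⟩
  rw [e, ← C_eq_natCast, ← C_pow, coeff_C_mul]

theorem mul_sum_C_mul_mem {s : Finset ℕ} {c d : ℕ → ℚ} {f : ℕ → ℚ[X]} {m : ℕ}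
    (hc : ∀ i ∈ s, ∃ r ∈ pIntegralSubring p, c i = d i + (p : ℚ) ^ m * r)
    (hf : ∀ i, f i ∈ pIntegralPoly p) :
    ∃ h ∈ pIntegralPoly p,
      ∑ i ∈ s, C (c i) * f i = ∑ i ∈ s, C (d i) * f i + (p : ℚ[X]) ^ m * h := by
  choose! r hr e using hc
  refine ⟨∑ i ∈ s, C (r i) * f i, Subring.sum_mem _ fun i hi =>
    Subring.mul_mem _ (C_mem_pIntegralPoly (hr i hi)) (hf i), ?_⟩
  rw [Finset.mul_sum, ← Finset.sum_add_distrib]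
  refine Finset.sum_congr rfl fun i hi => ?_
  rw [e i hi, C_add, C_mul, C_pow, C_eq_natCast]
  ring

end Integrality

/-! ### Binomial coefficients and harmonic sums modulo powers of `p` -/

section Rational

variable {p : ℕ} [hp : Fact p.Prime]

theorem exists_choose_succ_eq {j : ℕ} (hj : j + 1 < p) :
    ∃ r ∈ pIntegralSubring p,
      (-1) ^ j * (p.choose (j + 1) : ℚ) =
        p / (j + 1) * (1 - p * harmonic j) + (p : ℚ) ^ 3 * r := by
  induction j with
  | zero => exact ⟨0, Subring.zero_mem _, by simp⟩
  | succ j ih =>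
    obtain ⟨r, hr, e⟩ := ih (by omega)
    have hp0 : j + 1 ≤ p := by omega
    have h := congrArg (Nat.cast (R := ℚ)) (Nat.choose_succ_right_eq p (j + 1))
    push_cast [Nat.cast_sub hp0] at h
    have ha : (j : ℚ) + 1 ≠ 0 := by positivity
    have hb : (j : ℚ) + 1 + 1 ≠ 0 := by positivity
    have hai := inv_succ_mem_pIntegralSubring (by omega : j + 1 < p)
    have hbi := inv_succ_mem_pIntegralSubring hj
    push_cast at hbi
    refine ⟨(harmonic j * (j + 1 : ℚ)⁻¹ + r * (j + 1 - p)) * ((j : ℚ) + 1 + 1)⁻¹,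
      mul_mem (add_mem (mul_mem (harmonic_mem_pIntegralSubring (by omega)) hai)
        (mul_mem hr (sub_mem (add_mem (natCast_mem _ j) (one_mem _)) (natCast_mem _ p)))) hbi, ?_⟩
    have e' : (-1) ^ (j + 1) * (p.choose (j + 1 + 1) : ℚ) * (j + 1 + 1) =
        (p / (j + 1) * (1 - p * harmonic j) + (p : ℚ) ^ 3 * r) * (j + 1 - p) := by
      rw [← e, pow_succ]
      linear_combination -(-1 : ℚ) ^ j * h
    rw [harmonic_succ, ← mul_left_inj' hb, e']
    push_cast
    field_simp
    ring

theorem exists_choose_pred_eq {j : ℕ} (hj : j < p) :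
    ∃ r ∈ pIntegralSubring p, (-1) ^ j * ((p - 1).choose j : ℚ) = 1 + p * r := by
  induction j with
  | zero => exact ⟨0, zero_mem _, by simp⟩
  | succ j ih =>
    obtain ⟨r, hr, e⟩ := ih (by omega)
    obtain ⟨c, hc⟩ := hp.out.dvd_choose_self (Nat.succ_ne_zero j) hj
    have h := Nat.choose_succ_succ (p - 1) j
    rw [Nat.succ_eq_add_one, Nat.sub_add_cancel hp.out.one_le, hc] at h
    have h' := congrArg (Nat.cast (R := ℚ)) h
    push_cast at h'
    refine ⟨r - (-1) ^ j * c,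
      sub_mem hr (mul_mem (pow_mem (neg_mem (one_mem _)) j) (natCast_mem _ c)), ?_⟩
    rw [pow_succ]
    linear_combination e + (-1) ^ j * h'

/-- In `C(2p, p) = ∑ C(p, i)^2` every term except the two outer ones is divisible by `p^2`. -/
theorem exists_centralBinom_eq :
    ∃ r ∈ pIntegralSubring p, ((2 * p).choose p : ℚ) = 2 + (p : ℚ) ^ 2 * r := by
  obtain ⟨q, rfl⟩ : ∃ q, p = q + 1 := ⟨p - 1, (Nat.sub_add_cancel hp.out.one_le).symm⟩
  have h : ∀ i ∈ Finset.range q, ∃ r ∈ pIntegralSubring (q + 1),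
      ((q + 1).choose (i + 1) : ℚ) ^ 2 = ((q + 1 : ℕ) : ℚ) ^ 2 * r := by
    intro i hi
    rw [Finset.mem_range] at hi
    obtain ⟨c, hc⟩ := hp.out.dvd_choose_self (Nat.succ_ne_zero i) (by omega)
    exact ⟨(c : ℚ) ^ 2, pow_mem (natCast_mem _ c) 2, by rw [hc]; push_cast; ring⟩
  choose! r hr e using h
  refine ⟨∑ i ∈ Finset.range q, r i, sum_mem hr, ?_⟩
  rw [← Nat.sum_range_choose_sq, Finset.sum_range_succ, Finset.sum_range_succ']
  push_cast at e ⊢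
  rw [Finset.sum_congr rfl e, Finset.mul_sum]
  simp
  ring

theorem exists_choose_two_mul_eq {j : ℕ} (hj : j + 1 < p) :
    ∃ r ∈ pIntegralSubring p,
      (-1) ^ j * ((2 * p).choose (p + 1 + j) : ℚ) =
        2 * p / (j + 1) * (1 - p * harmonic j - p * harmonic (j + 1)) + (p : ℚ) ^ 3 * r := by
  have hinv : ∀ i : ℕ, i + 1 < p → ((p : ℚ) + (i + 1))⁻¹ ∈ pIntegralSubring p := by
    intro i hi
    have := inv_natCast_mem_pIntegralSubring (p := p) (n := p + (i + 1)) (by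
      rw [Nat.dvd_add_right (dvd_refl p)]
      exact Nat.not_dvd_of_pos_of_lt (Nat.succ_pos i) hi)
    exact_mod_cast this
  induction j with
  | zero =>
    obtain ⟨s, hs, e⟩ := exists_centralBinom_eq (p := p)
    have h := congrArg (Nat.cast (R := ℚ)) (Nat.choose_succ_right_eq (2 * p) p)
    -- The relation `C(2p, p+1) (p+1) = C(2p, p) p` supplies one more factor `p`, so `C(2p, p)` is
    -- needed only modulo `p^2`.
    rw [show 2 * p - p = p by omega] at h
    push_cast at h
    refine ⟨(s + 2) * ((p : ℚ) + ((0 : ℕ) + 1))⁻¹, mul_mem (add_mem hs (ofNat_mem _ 2))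
      (hinv 0 hj), ?_⟩
    have hb : (p : ℚ) + 1 ≠ 0 := by positivity
    rw [← mul_left_inj' hb]
    simp only [pow_zero, one_mul, add_zero, Nat.cast_zero, zero_add, harmonic_zero, harmonic_succ]
    rw [h, e]
    field_simp
    push_cast
    ring
  | succ j ih =>
    obtain ⟨r, hr, e⟩ := ih (by omega)
    have h := congrArg (Nat.cast (R := ℚ)) (Nat.choose_succ_right_eq (2 * p) (p + 1 + j))
    rw [show 2 * p - (p + 1 + j) = p - (j + 1) by omega] at h
    have hp0 : j + 1 ≤ p := by omega
    push_cast [Nat.cast_sub hp0] at h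
    have ha : (j : ℚ) + 1 ≠ 0 := by positivity
    have hb : (j : ℚ) + 1 + 1 ≠ 0 := by positivity
    have hc : (p : ℚ) + (j + 1 + 1) ≠ 0 := by positivity
    have hai := inv_succ_mem_pIntegralSubring (by omega : j + 1 < p)
    have hbi := inv_succ_mem_pIntegralSubring hj
    have hci := hinv (j + 1) hj
    have hH := harmonic_mem_pIntegralSubring (by omega : j < p)
    have h2 : (2 : ℚ) ∈ pIntegralSubring p := ofNat_mem _ 2
    push_cast at hbi hci
    refine ⟨(2 * (j + 1 : ℚ)⁻¹ * (2 * harmonic j + (j + 1 : ℚ)⁻¹) +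
      2 * (j + 1 + 1 : ℚ)⁻¹ * (2 * harmonic j + 2 * (j + 1 : ℚ)⁻¹ + (j + 1 + 1 : ℚ)⁻¹) +
      r * (j + 1 - p)) * ((p : ℚ) + (j + 1 + 1))⁻¹,
      mul_mem (add_mem (add_mem (mul_mem (mul_mem h2 hai) (add_mem (mul_mem h2 hH) hai))
        (mul_mem (mul_mem h2 hbi) (add_mem (add_mem (mul_mem h2 hH) (mul_mem h2 hai)) hbi)))
        (mul_mem hr (sub_mem (add_mem (natCast_mem _ j) (one_mem _)) (natCast_mem _ p)))) hci, ?_⟩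
    have e' : (-1) ^ (j + 1) * ((2 * p).choose (p + 1 + j + 1) : ℚ) * (p + (j + 1 + 1)) =
        (2 * p / (j + 1) * (1 - p * harmonic j - p * harmonic (j + 1)) + (p : ℚ) ^ 3 * r) *
          (j + 1 - p) := by
      rw [← e, pow_succ]
      linear_combination -(-1 : ℚ) ^ j * h
    rw [← add_assoc, ← mul_left_inj' hc, e', harmonic_succ (j + 1), harmonic_succ j]
    push_cast
    field_simp
    ring

/-- Follows termwise from `C(k, i) + C(k, i+1) = C(k+1, i+1) = (k+1)/(i+1) C(k, i)`. This drives the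
inductions on `i` below, with weights `1` and `1/(k+1)`. -/
theorem sum_choose_div_succ (c : ℕ → ℚ) (q i : ℕ) :
    (-1) ^ (i + 1) * ∑ k ∈ Finset.range q, (k.choose (i + 1) : ℚ) / (k + 1) * c k =
      (-1) ^ i * ∑ k ∈ Finset.range q, (k.choose i : ℚ) / (k + 1) * c k +
        (-1) ^ (i + 1) * (i + 1 : ℚ)⁻¹ * ∑ k ∈ Finset.range q, (k.choose i : ℚ) * c k := by
  have h : ∑ k ∈ Finset.range q, (k.choose (i + 1) : ℚ) / (k + 1) * c k +
      ∑ k ∈ Finset.range q, (k.choose i : ℚ) / (k + 1) * c k =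
        (i + 1 : ℚ)⁻¹ * ∑ k ∈ Finset.range q, (k.choose i : ℚ) * c k := by
    rw [← Finset.sum_add_distrib, Finset.mul_sum]
    refine Finset.sum_congr rfl fun k _ => ?_
    have h := congrArg (Nat.cast (R := ℚ)) (Nat.add_one_mul_choose_eq k i)
    rw [Nat.choose_succ_succ] at h
    push_cast at h
    have : (k : ℚ) + 1 ≠ 0 := by positivity
    have : (i : ℚ) + 1 ≠ 0 := by positivity
    field_simp
    linear_combination -c k * h
  linear_combination (-1) ^ (i + 1) * h

theorem sum_range_choose_right (q i : ℕ) :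
    ∑ k ∈ Finset.range q, (k.choose i : ℚ) = q.choose (i + 1) := by
  induction q with
  | zero => simp
  | succ q ih =>
    rw [Finset.sum_range_succ, ih, Nat.choose_succ_succ]
    push_cast
    ring

theorem exists_sum_choose_div_eq_harmonic_add {i : ℕ} (hi : i < p) :
    ∃ r ∈ pIntegralSubring p,
      (-1) ^ i * ∑ k ∈ Finset.range (p - 1), (k.choose i : ℚ) / (k + 1) =
        harmonic (p - 1) + harmonic i + p * r := by
  induction i with
  | zero => exact ⟨0, zero_mem _, by simp [harmonic]⟩
  | succ i ih =>
    obtain ⟨r, hr, e⟩ := ih (by omega)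
    have h := sum_choose_div_succ (fun _ => 1) (p - 1) i
    simp only [mul_one] at h
    rw [sum_range_choose_right, e] at h
    have hii := inv_succ_mem_pIntegralSubring hi
    obtain ⟨s, hs, e'⟩ := exists_choose_pred_eq hi
    refine ⟨r + s * (i + 1 : ℚ)⁻¹, add_mem hr (mul_mem hs hii), ?_⟩
    rw [h, harmonic_succ]
    push_cast
    linear_combination (i + 1 : ℚ)⁻¹ * e'

theorem exists_harmonic_pred_eq (hp2 : p ≠ 2) :
    ∃ r ∈ pIntegralSubring p, harmonic (p - 1) = p * r := by
  obtain ⟨r, hr, e⟩ := exists_sum_choose_div_eq_harmonic_add (p := p) (i := p - 1)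
    (Nat.sub_lt hp.out.pos one_pos)
  have h2 : ((2 : ℕ) : ℚ)⁻¹ ∈ pIntegralSubring p := inv_natCast_mem_pIntegralSubring
    fun h => hp2 ((Nat.prime_dvd_prime_iff_eq hp.out Nat.prime_two).1 h)
  -- At `i = p - 1` every `C(k, i)` with `k < p - 1` vanishes, leaving `0 = 2 H_{p-1} + p r`.
  rw [Finset.sum_eq_zero fun k hk => by
    rw [Nat.choose_eq_zero_of_lt (Finset.mem_range.1 hk)]; simp] at e
  refine ⟨-r * ((2 : ℕ) : ℚ)⁻¹, mul_mem (neg_mem hr) h2, ?_⟩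
  push_cast
  linear_combination -(1 / 2 : ℚ) * e

theorem exists_sum_choose_div_eq_harmonic (hp2 : p ≠ 2) {i : ℕ} (hi : i < p) :
    ∃ r ∈ pIntegralSubring p,
      (-1) ^ i * ∑ k ∈ Finset.range (p - 1), (k.choose i : ℚ) / (k + 1) =
        harmonic i + p * r := by
  obtain ⟨r, hr, e⟩ := exists_sum_choose_div_eq_harmonic_add hi
  obtain ⟨s, hs, e'⟩ := exists_harmonic_pred_eq hp2
  exact ⟨r + s, add_mem hr hs, by rw [e, e']; ring⟩

theorem exists_sum_choose_div_sq_eq (hp2 : p ≠ 2) {i : ℕ} (hi : i < p) :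
    ∃ r ∈ pIntegralSubring p,
      (-1) ^ i * ∑ k ∈ Finset.range (p - 1), (k.choose i : ℚ) / (k + 1) * (k + 1 : ℚ)⁻¹ =
        ∑ k ∈ Finset.range (p - 1), ((k + 1 : ℚ) ^ 2)⁻¹
          - ∑ j ∈ Finset.range i, harmonic j * (j + 1 : ℚ)⁻¹ + p * r := by
  induction i with
  | zero =>
    refine ⟨0, zero_mem _, ?_⟩
    simp [sq]
  | succ i ih =>
    obtain ⟨r, hr, e⟩ := ih (by omega)
    obtain ⟨s, hs, e'⟩ := exists_sum_choose_div_eq_harmonic hp2 (by omega : i < p)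
    have h := sum_choose_div_succ (fun k => (k + 1 : ℚ)⁻¹) (p - 1) i
    refine ⟨r - (i + 1 : ℚ)⁻¹ * s,
      sub_mem hr (mul_mem (inv_succ_mem_pIntegralSubring hi) hs), ?_⟩
    rw [h, e, Finset.sum_range_succ]
    simp only [div_eq_mul_inv] at e' ⊢
    linear_combination -(i + 1 : ℚ)⁻¹ * e'

theorem harmonic_sq (n : ℕ) :
    harmonic n ^ 2 = ∑ k ∈ Finset.range n, ((k + 1 : ℚ) ^ 2)⁻¹
      + 2 * ∑ j ∈ Finset.range n, harmonic j * (j + 1 : ℚ)⁻¹ := by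
  induction n with
  | zero => simp
  | succ n ih =>
    rw [harmonic_succ, Finset.sum_range_succ, Finset.sum_range_succ, add_sq, ih]
    push_cast
    rw [inv_pow]
    ring

/-- Let `S` be this sum and `T = ∑ H_j/(j+1)`. Taking `i = p - 1` in the preceding congruence gives
`S ≡ T`, while `S + 2 T = H_{p-1}^2 ≡ 0`. Thus `3 S ≡ 0`, and `3` is invertible. -/
theorem exists_sum_inv_sq_eq (hp3 : 3 < p) :
    ∃ r ∈ pIntegralSubring p, ∑ k ∈ Finset.range (p - 1), ((k + 1 : ℚ) ^ 2)⁻¹ = p * r := by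
  obtain ⟨r, hr, e⟩ := exists_sum_choose_div_sq_eq (p := p) (by omega) (i := p - 1)
    (Nat.sub_lt hp.out.pos one_pos)
  obtain ⟨s, hs, e'⟩ := exists_harmonic_pred_eq (p := p) (by omega)
  have h3 : ((3 : ℕ) : ℚ)⁻¹ ∈ pIntegralSubring p := inv_natCast_mem_pIntegralSubring
    (Nat.not_dvd_of_pos_of_lt three_pos hp3)
  have h := harmonic_sq (p - 1)
  rw [Finset.sum_eq_zero fun k hk => by
    rw [Nat.choose_eq_zero_of_lt (Finset.mem_range.1 hk)]; simp] at e
  refine ⟨(p * s ^ 2 - 2 * r) * ((3 : ℕ) : ℚ)⁻¹,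
    mul_mem (sub_mem (mul_mem (natCast_mem _ p) (pow_mem hs 2)) (mul_mem (ofNat_mem _ 2) hr)) h3, ?_⟩
  rw [e'] at h
  push_cast
  linear_combination -(1 / 3 : ℚ) * h - (2 / 3 : ℚ) * e

end Rational

/-! ### Expansions in the Lucas polynomials `u_j(t - 2)` -/

section LucasIdentities

variable {R : Type*} [CommRing R]

theorem lucasU_add_two (x y : R) (n : ℕ) :
    lucasU x y (n + 2) = x * lucasU x y (n + 1) - y * lucasU x y n := rfl

theorem lucasV_add_two (x y : R) (n : ℕ) :
    lucasV x y (n + 2) = x * lucasV x y (n + 1) - y * lucasV x y n := rfl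

theorem lucasU_neg (x y : R) : ∀ n, lucasU (-x) y n = (-1) ^ (n + 1) * lucasU x y n
  | 0 => by simp [lucasU]
  | 1 => by simp [lucasU]
  | n + 2 => by
    rw [lucasU_add_two, lucasU_add_two, lucasU_neg x y (n + 1), lucasU_neg x y n]
    ring

theorem lucasV_eq (x y : R) : ∀ n, lucasV x y n = 2 * lucasU x y (n + 1) - x * lucasU x y n
  | 0 => by simp [lucasU, lucasV]
  | 1 => by simp [lucasU, lucasV]; ring
  | n + 2 => by
    rw [lucasV_add_two, lucasV_eq x y (n + 1), lucasV_eq x y n, lucasU_add_two x y (n + 1),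
      lucasU_add_two x y n]
    ring

/-- Summation by parts, using `u_j + 2 u_{j+1} + u_{j+2} = t u_{j+1}` at the argument `t - 2`. -/
theorem sum_second_difference_mul_lucasU (t : R) (f : ℕ → R) (N : ℕ) :
    ∑ j ∈ Finset.range N, (f j + 2 * f (j + 1) + f (j + 2)) * lucasU (t - 2) 1 (j + 1) =
      f 0 + t * ∑ j ∈ Finset.range N, f (j + 1) * lucasU (t - 2) 1 (j + 1)
        - f N * lucasU (t - 2) 1 (N + 1) + f (N + 1) * lucasU (t - 2) 1 N := by
  induction N with
  | zero => simp [lucasU]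
  | succ N ih =>
    rw [Finset.sum_range_succ, Finset.sum_range_succ, ih, lucasU_add_two]
    ring

/-- Both sides satisfy `S_{n+1} = t S_n + C(2n, n)`; on the right, Pascal's rule applied twice
produces the second-difference pattern. The free bound `N` keeps the range fixed during the
induction, since the extra binomials vanish. -/
theorem sum_centralBinom_mul_pow (t : R) {n N : ℕ} (h : n ≤ N) :
    ∑ k ∈ Finset.range n, ((2 * k).choose k : R) * t ^ (n - 1 - k) =
      ∑ j ∈ Finset.range N, ((2 * n).choose (n + 1 + j) : R) * lucasU (t - 2) 1 (j + 1) := by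
  induction n with
  | zero =>
    rw [Finset.sum_range_zero, Finset.sum_eq_zero]
    intro j _
    rw [Nat.choose_eq_zero_of_lt (by omega)]
    simp
  | succ n ih =>
    have h1 : ∑ k ∈ Finset.range (n + 1), ((2 * k).choose k : R) * t ^ (n + 1 - 1 - k) =
        t * ∑ k ∈ Finset.range n, ((2 * k).choose k : R) * t ^ (n - 1 - k)
          + ((2 * n).choose n : R) := by
      rw [Finset.sum_range_succ, Finset.mul_sum]
      congr 1
      · refine Finset.sum_congr rfl fun k hk => ?_
        rw [Finset.mem_range] at hk
        rw [show n + 1 - 1 - k = n - 1 - k + 1 by omega, pow_succ]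
        ring
      · simp
    have h2 := sum_second_difference_mul_lucasU t (fun j => ((2 * n).choose (n + j) : R)) N
    simp only [Nat.choose_eq_zero_of_lt (show 2 * n < n + N by omega),
      Nat.choose_eq_zero_of_lt (show 2 * n < n + (N + 1) by omega), Nat.cast_zero, zero_mul,
      sub_zero, add_zero] at h2
    rw [h1, ih (by omega), add_comm]
    simp only [add_right_comm n 1]
    simp only [add_assoc n] at h2 ⊢
    rw [← h2]
    refine Finset.sum_congr rfl fun j _ => ?_
    rw [show 2 * (n + 1) = 2 * n + 1 + 1 by ring, show n + (1 + 1 + j) = n + j + 1 + 1 by ring,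
      Nat.choose_succ_succ' (2 * n + 1), Nat.choose_succ_succ' (2 * n),
      Nat.choose_succ_succ' (2 * n) (n + j + 1)]
    push_cast [add_assoc]
    ring

theorem sum_choose_succ_mul_shift (e : ℕ → R) (n m : ℕ) :
    ∑ i ∈ Finset.range (n + 2), ((n + 1).choose i : R) * e (i + m) =
      ∑ i ∈ Finset.range (n + 1), (n.choose i : R) * e (i + m) +
        ∑ i ∈ Finset.range (n + 1), (n.choose i : R) * e (i + (m + 1)) := by
  rw [Finset.sum_choose_succ_mul fun i _ => e (i + m)]
  simp only [add_assoc, add_comm 1 m]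

/-- The binomial theorem for the roots `1 + a` and `1 + 1/a`, proved without roots by Pascal's rule
and the recurrence. -/
theorem lucasU_self_eq_sum (t : R) : ∀ n,
    lucasU t t n = ∑ i ∈ Finset.range (n + 1), (n.choose i : R) * lucasU (t - 2) 1 i
  | 0 => by simp [lucasU]
  | 1 => by simp [lucasU, Finset.sum_range_succ]
  | n + 2 => by
    have h1 := sum_choose_succ_mul_shift (lucasU (t - 2) 1) (n + 1) 0
    have h2 := sum_choose_succ_mul_shift (lucasU (t - 2) 1) n 0
    have h3 := sum_choose_succ_mul_shift (lucasU (t - 2) 1) n 1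
    have h4 : ∑ i ∈ Finset.range (n + 1), (n.choose i : R) * lucasU (t - 2) 1 (i + 2) =
        (t - 2) * ∑ i ∈ Finset.range (n + 1), (n.choose i : R) * lucasU (t - 2) 1 (i + 1)
          - ∑ i ∈ Finset.range (n + 1), (n.choose i : R) * lucasU (t - 2) 1 i := by
      rw [Finset.mul_sum, ← Finset.sum_sub_distrib]
      refine Finset.sum_congr rfl fun i _ => ?_
      rw [lucasU_add_two]
      ring
    simp only [add_zero, zero_add, Nat.reduceAdd] at h1 h2 h3
    rw [lucasU_add_two, lucasU_self_eq_sum t (n + 1), lucasU_self_eq_sum t n, h1, h3, h4, h2]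
    ring

theorem lucasU_self_eq_sum_succ (t : R) (n : ℕ) :
    lucasU t t n =
      ∑ j ∈ Finset.range n, (-1) ^ j * (n.choose (j + 1) : R) * lucasU (2 - t) 1 (j + 1) := by
  rw [lucasU_self_eq_sum, Finset.sum_range_succ', ← neg_sub 2 t]
  simp only [lucasU_neg, lucasU, mul_zero, add_zero]
  refine Finset.sum_congr rfl fun j _ => ?_
  ring

theorem sum_centralBinom_mul_pow' (t : R) (n : ℕ) :
    ∑ k ∈ Finset.range n, ((2 * k).choose k : R) * t ^ (n - 1 - k) =
      ∑ j ∈ Finset.range n,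
        (-1) ^ j * ((2 * n).choose (n + 1 + j) : R) * lucasU (2 - t) 1 (j + 1) := by
  rw [sum_centralBinom_mul_pow t le_rfl, ← neg_sub 2 t]
  simp only [lucasU_neg]
  refine Finset.sum_congr rfl fun j _ => ?_
  ring

end LucasIdentities

/-! ### Derivatives, degrees and extreme coefficients of `v_n` -/

section LucasPolynomials

variable {R : Type*} [CommRing R]

theorem X_mul_derivative_lucasV_X_X : ∀ n,
    X * derivative (lucasV (X : R[X]) X n) = (n : R[X]) * lucasU X X (n + 1)
  | 0 => by simp [lucasV]
  | 1 => by simp [lucasV, lucasU]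
  | n + 2 => by
    have h1 := X_mul_derivative_lucasV_X_X (n + 1)
    have h2 := X_mul_derivative_lucasV_X_X n
    rw [lucasV_add_two, derivative_sub, derivative_mul, derivative_mul, derivative_X,
      lucasV_eq _ _ (n + 1), lucasV_eq _ _ n] at *
    rw [lucasU_add_two _ _ (n + 1), lucasU_add_two _ _ n] at *
    push_cast at *
    linear_combination X * h1 - X * h2

theorem derivative_lucasV_two_sub_X : ∀ n,
    derivative (lucasV (2 - X : R[X]) 1 n) = -((n : R[X]) * lucasU (2 - X) 1 n)
  | 0 => by simp [lucasV]
  | 1 => by simp [lucasV, lucasU]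
  | n + 2 => by
    have h1 := derivative_lucasV_two_sub_X (n + 1)
    have h2 := derivative_lucasV_two_sub_X n
    rw [lucasV_add_two, derivative_sub, derivative_mul, derivative_mul, h1, h2, lucasV_eq]
    simp only [derivative_sub, derivative_ofNat, derivative_X, derivative_one]
    rw [lucasU_add_two _ _ n]
    push_cast
    ring

theorem natDegree_lucasV_le {x y : R[X]} (hx : x.natDegree ≤ 1) (hy : y.natDegree ≤ 1) :
    ∀ n, (lucasV x y n).natDegree ≤ n
  | 0 => by simp [lucasV]
  | 1 => hx
  | n + 2 => by
    refine (natDegree_sub_le _ _).trans (max_le ?_ ?_)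
    · exact (natDegree_mul_le_of_le hx (natDegree_lucasV_le hx hy (n + 1))).trans (by omega)
    · exact (natDegree_mul_le_of_le hy (natDegree_lucasV_le hx hy n)).trans (by omega)

theorem coeff_lucasV_succ {x y : R[X]} (hx : x.natDegree ≤ 1) (hy : y.natDegree ≤ 1) :
    ∀ n, (lucasV x y (n + 1)).coeff (n + 1) = x.coeff 1 ^ (n + 1)
  | 0 => by simp [lucasV]
  | n + 1 => by
    have h : (y * lucasV x y n).coeff (n + 1 + 1) = 0 := coeff_eq_zero_of_natDegree_lt
      ((natDegree_mul_le_of_le hy (natDegree_lucasV_le hx hy n)).trans_lt (by omega))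
    rw [lucasV_add_two, coeff_sub, h, sub_zero, add_comm (n + 1) 1,
      coeff_mul_add_eq_of_natDegree_le hx (natDegree_lucasV_le hx hy (n + 1)),
      coeff_lucasV_succ hx hy n, ← pow_succ', add_comm]

theorem lucasV_two_one : ∀ n, lucasV (2 : R) 1 n = 2
  | 0 => rfl
  | 1 => rfl
  | n + 2 => by
    rw [lucasV_add_two, lucasV_two_one (n + 1), lucasV_two_one n]
    ring

theorem lucasV_zero_zero_succ : ∀ n, lucasV (0 : R) 0 (n + 1) = 0
  | 0 => rfl
  | n + 1 => by rw [lucasV_add_two]; ring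

theorem map_lucasV {S : Type*} [CommRing S] (f : R →+* S) (x y : R) :
    ∀ n, f (lucasV x y n) = lucasV (f x) (f y) n
  | 0 => map_ofNat f 2
  | 1 => rfl
  | n + 2 => by
    simp only [lucasV_add_two, map_sub, map_mul, map_lucasV f x y (n + 1), map_lucasV f x y n]

theorem coeff_zero_lucasV_two_sub_X (n : ℕ) : (lucasV (2 - X : R[X]) 1 n).coeff 0 = 2 := by
  rw [← constantCoeff_apply, map_lucasV]
  simp [lucasV_two_one]

theorem coeff_zero_lucasV_X_X (n : ℕ) : (lucasV (X : R[X]) X (n + 1)).coeff 0 = 0 := by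
  rw [← constantCoeff_apply, map_lucasV]
  simp [lucasV_zero_zero_succ]

end LucasPolynomials

theorem sum_Icc_one_eq_sum_range {M : Type*} [AddCommMonoid M] (f : ℕ → M) (n : ℕ) :
    ∑ k ∈ Finset.Icc 1 n, f k = ∑ j ∈ Finset.range n, f (j + 1) := by
  induction n with
  | zero => simp
  | succ n ih => rw [Finset.sum_Icc_succ_top (by omega), Finset.sum_range_succ, ih]

/-- The sum `∑ c_j u_{j+1}(2 - t)` over `0 ≤ j < p - 1`. -/
noncomputable def lucasSum (p : ℕ) (c : ℕ → ℚ) : ℚ[X] :=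
  ∑ j ∈ Finset.range (p - 1), C (c j) * lucasU (2 - X) 1 (j + 1)

theorem lucasSum_add {p : ℕ} (c d : ℕ → ℚ) :
    lucasSum p (fun j => c j + d j) = lucasSum p c + lucasSum p d := by
  simp only [lucasSum, C_add, add_mul, Finset.sum_add_distrib]

theorem lucasSum_mul_left {p : ℕ} (a : ℚ) (c : ℕ → ℚ) :
    lucasSum p (fun j => a * c j) = C a * lucasSum p c := by
  simp only [lucasSum, C_mul, mul_assoc, Finset.mul_sum]

/-! ### Expansions modulo `p^3` and the divisibility criterion -/

section PrimeCongruences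

variable {p : ℕ} [hp : Fact p.Prime]

theorem lucasU_two_sub_X_mem (n : ℕ) : lucasU (2 - X : ℚ[X]) 1 n ∈ pIntegralPoly p :=
  lucasU_mem (sub_mem (ofNat_mem _ 2) X_mem_pIntegralPoly) (one_mem _) n

theorem lucasSum_mem {c : ℕ → ℚ} (hc : ∀ j < p - 1, c j ∈ pIntegralSubring p) :
    lucasSum p c ∈ pIntegralPoly p :=
  sum_mem fun j hj => mul_mem (C_mem_pIntegralPoly (hc j (Finset.mem_range.1 hj)))
    (lucasU_two_sub_X_mem _)

theorem inv_mem_of_lt_pred {j : ℕ} (hj : j < p - 1) : (j + 1 : ℚ)⁻¹ ∈ pIntegralSubring p :=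
  inv_succ_mem_pIntegralSubring (by omega)

theorem lucasSum_inv_mem : lucasSum p (fun j => (j + 1 : ℚ)⁻¹) ∈ pIntegralPoly p :=
  lucasSum_mem fun _ hj => inv_mem_of_lt_pred hj

theorem lucasSum_inv_sq_mem : lucasSum p (fun j => (j + 1 : ℚ)⁻¹ ^ 2) ∈ pIntegralPoly p :=
  lucasSum_mem fun _ hj => pow_mem (inv_mem_of_lt_pred hj) 2

theorem lucasSum_harmonic_mem :
    lucasSum p (fun j => (j + 1 : ℚ)⁻¹ * harmonic j) ∈ pIntegralPoly p :=
  lucasSum_mem fun _ hj => mul_mem (inv_mem_of_lt_pred hj)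
    (harmonic_mem_pIntegralSubring (by omega))

theorem exists_lucasU_self_eq (hp2 : p ≠ 2) :
    ∃ h ∈ pIntegralPoly p, lucasU (X : ℚ[X]) X p =
      lucasU (2 - X) 1 p + (p : ℚ[X]) * lucasSum p (fun j => (j + 1 : ℚ)⁻¹)
        - (p : ℚ[X]) ^ 2 * lucasSum p (fun j => (j + 1 : ℚ)⁻¹ * harmonic j)
        + (p : ℚ[X]) ^ 3 * h := by
  obtain ⟨h, hh, e⟩ := mul_sum_C_mul_mem (p := p) (s := Finset.range (p - 1)) (m := 3)
    (c := fun j => (-1) ^ j * (p.choose (j + 1) : ℚ))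
    (d := fun j => p * (j + 1 : ℚ)⁻¹ + (-p ^ 2) * ((j + 1 : ℚ)⁻¹ * harmonic j))
    (f := fun j => lucasU (2 - X) 1 (j + 1))
    (fun j hj => by
      rw [Finset.mem_range] at hj
      obtain ⟨r, hr, e⟩ := exists_choose_succ_eq (p := p) (j := j) (by omega)
      exact ⟨r, hr, by rw [e, div_eq_mul_inv]; ring⟩)
    (fun j => lucasU_two_sub_X_mem _)
  refine ⟨h, hh, ?_⟩
  have e2 := lucasSum_add (p := p) (fun j => p * (j + 1 : ℚ)⁻¹)
    (fun j => (-p ^ 2) * ((j + 1 : ℚ)⁻¹ * harmonic j))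
  rw [lucasSum_mul_left, lucasSum_mul_left] at e2
  unfold lucasSum at e2 ⊢
  rw [e2] at e
  obtain ⟨q, rfl⟩ : ∃ q, p = q + 1 := ⟨p - 1, (Nat.sub_add_cancel hp.out.one_le).symm⟩
  have hq : Even q := by simpa using hp.out.even_sub_one hp2
  -- The last index `j = p - 1` has coefficient exactly `1` and yields `u_p(2 - X)`.
  rw [lucasU_self_eq_sum_succ, Finset.sum_range_succ, hq.neg_one_pow, Nat.choose_self]
  simp only [Nat.add_sub_cancel, C_mul, C_neg, C_pow, C_1, map_natCast] at e ⊢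
  rw [e]
  push_cast
  ring

theorem exists_sum_centralBinom_eq (hp2 : p ≠ 2) :
    ∃ h ∈ pIntegralPoly p,
      ∑ k ∈ Finset.range p, ((2 * k).choose k : ℚ[X]) * X ^ (p - 1 - k) =
      lucasU (2 - X) 1 p + 2 * (p : ℚ[X]) * lucasSum p (fun j => (j + 1 : ℚ)⁻¹)
        - 4 * (p : ℚ[X]) ^ 2 * lucasSum p (fun j => (j + 1 : ℚ)⁻¹ * harmonic j)
        - 2 * (p : ℚ[X]) ^ 2 * lucasSum p (fun j => (j + 1 : ℚ)⁻¹ ^ 2)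
        + (p : ℚ[X]) ^ 3 * h := by
  obtain ⟨h, hh, e⟩ := mul_sum_C_mul_mem (p := p) (s := Finset.range (p - 1)) (m := 3)
    (c := fun j => (-1) ^ j * ((2 * p).choose (p + 1 + j) : ℚ))
    (d := fun j => 2 * p * (j + 1 : ℚ)⁻¹ + ((-4 * p ^ 2) * ((j + 1 : ℚ)⁻¹ * harmonic j) +
      (-2 * p ^ 2) * (j + 1 : ℚ)⁻¹ ^ 2))
    (f := fun j => lucasU (2 - X) 1 (j + 1))
    (fun j hj => by
      rw [Finset.mem_range] at hj
      obtain ⟨r, hr, e⟩ := exists_choose_two_mul_eq (p := p) (j := j) (by omega)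
      exact ⟨r, hr, by rw [e, div_eq_mul_inv, harmonic_succ]; push_cast; ring⟩)
    (fun j => lucasU_two_sub_X_mem _)
  refine ⟨h, hh, ?_⟩
  have e2 := lucasSum_add (p := p) (fun j => 2 * p * (j + 1 : ℚ)⁻¹)
    (fun j => (-4 * p ^ 2) * ((j + 1 : ℚ)⁻¹ * harmonic j) + (-2 * p ^ 2) * (j + 1 : ℚ)⁻¹ ^ 2)
  have e3 := lucasSum_add (p := p) (fun j => (-4 * p ^ 2) * ((j + 1 : ℚ)⁻¹ * harmonic j))
    (fun j => (-2 * p ^ 2) * (j + 1 : ℚ)⁻¹ ^ 2)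
  rw [lucasSum_mul_left, e3, lucasSum_mul_left, lucasSum_mul_left] at e2
  unfold lucasSum at e2 ⊢
  rw [e2] at e
  obtain ⟨q, rfl⟩ : ∃ q, p = q + 1 := ⟨p - 1, (Nat.sub_add_cancel hp.out.one_le).symm⟩
  have hq : Even q := by simpa using hp.out.even_sub_one hp2
  rw [sum_centralBinom_mul_pow', Finset.sum_range_succ, hq.neg_one_pow,
    show q + 1 + 1 + q = 2 * (q + 1) by ring, Nat.choose_self]
  simp only [Nat.add_sub_cancel, C_mul, C_neg, C_pow, C_1, map_natCast,
    map_ofNat] at e ⊢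
  rw [e]
  push_cast
  ring

/-- Expand each `u_{k+1}(X, X)` in the `u_{j+1}(2 - X)` and exchange the sums. The inner sum over
`k` is then `H_j` modulo `p`. -/
theorem exists_sum_lucasU_self_div_sq_eq (hp2 : p ≠ 2) :
    ∃ h ∈ pIntegralPoly p,
      ∑ k ∈ Finset.range (p - 1), C ((k + 1 : ℚ)⁻¹ ^ 2) * lucasU X X (k + 1) =
        lucasSum p (fun j => (j + 1 : ℚ)⁻¹ * harmonic j) + (p : ℚ[X]) * h := by
  obtain ⟨h, hh, e⟩ := mul_sum_C_mul_mem (p := p) (s := Finset.range (p - 1)) (m := 1)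
    (c := fun j => (j + 1 : ℚ)⁻¹ *
      ((-1) ^ j * ∑ k ∈ Finset.range (p - 1), (k.choose j : ℚ) / (k + 1)))
    (d := fun j => (j + 1 : ℚ)⁻¹ * harmonic j)
    (f := fun j => lucasU (2 - X) 1 (j + 1))
    (fun j hj => by
      rw [Finset.mem_range] at hj
      obtain ⟨r, hr, e⟩ := exists_sum_choose_div_eq_harmonic hp2 (i := j) (by omega)
      exact ⟨(j + 1 : ℚ)⁻¹ * r, mul_mem (inv_mem_of_lt_pred hj) hr, by rw [e]; ring⟩)
    (fun j => lucasU_two_sub_X_mem _)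
  refine ⟨h, hh, ?_⟩
  rw [pow_one] at e
  rw [lucasSum, ← e]
  simp only [Finset.mul_sum, map_sum, Finset.sum_mul]
  rw [Finset.sum_comm]
  refine Finset.sum_congr rfl fun k hk => ?_
  rw [lucasU_self_eq_sum_succ, Finset.mul_sum]
  rw [Finset.mem_range] at hk
  refine (Finset.sum_subset (Finset.range_subset_range.2 hk) fun j _ hj => ?_).trans
    (Finset.sum_congr rfl fun j _ => ?_)
  · rw [Nat.choose_eq_zero_of_lt (by simpa using hj)]
    simp
  · have h1 := congrArg (Nat.cast (R := ℚ)) (Nat.add_one_mul_choose_eq k j)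
    push_cast at h1
    have hk0 : (k : ℚ) + 1 ≠ 0 := by positivity
    have hj0 : (j : ℚ) + 1 ≠ 0 := by positivity
    have h2 : (k + 1 : ℚ)⁻¹ ^ 2 * ((-1) ^ j * ((k + 1).choose (j + 1) : ℚ)) =
        (j + 1 : ℚ)⁻¹ * ((-1) ^ j * ((k.choose j : ℚ) / (k + 1))) := by
      field_simp
      linear_combination -h1
    rw [← h2]
    simp only [C_mul, C_pow, C_neg, C_1, map_natCast]
    ring

theorem exists_eq_pow_mul_of_X_mul_derivative {F h : ℚ[X]} {m : ℕ} (j : ℤ)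
    (h0 : ∃ r ∈ pIntegralSubring p, F.coeff 0 = (p : ℚ) ^ m * r)
    (hdeg : F.natDegree ≤ p) (htop : F.coeff p = 0) (hh : h ∈ pIntegralPoly p)
    (e : X * derivative F - (p : ℚ[X]) * (j : ℚ[X]) * F = (p : ℚ[X]) ^ m * h) :
    ∃ g ∈ pIntegralPoly p, F = (p : ℚ[X]) ^ m * g := by
  have hp0 : (p : ℚ) ^ m ≠ 0 := pow_ne_zero _ (Nat.cast_ne_zero.2 hp.out.ne_zero)
  refine ⟨C ((p : ℚ) ^ m)⁻¹ * F, fun n => ?_, ?_⟩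
  · rw [coeff_C_mul]
    rcases Nat.eq_zero_or_pos n with rfl | hn
    · obtain ⟨r, hr, e0⟩ := h0
      rwa [e0, inv_mul_cancel_left₀ hp0]
    rcases lt_trichotomy n p with hnp | rfl | hnp
    · have hd : ¬ (p : ℤ) ∣ n - p * j := by
        rw [dvd_sub_left (dvd_mul_right _ _), Int.natCast_dvd_natCast]
        exact Nat.not_dvd_of_pos_of_lt hn hnp
      have hc : (((n - p * j : ℤ) : ℚ)) * F.coeff n = (p : ℚ) ^ m * h.coeff n := by
        have := congrArg (fun f => coeff f n) e
        obtain ⟨k, rfl⟩ : ∃ k, n = k + 1 := ⟨n - 1, by omega⟩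
        simp only [← C_eq_natCast, ← C_eq_intCast, ← C_pow, ← C_mul, coeff_sub, coeff_C_mul,
          coeff_X_mul, coeff_derivative] at this
        rw [← this]
        push_cast
        ring
      have hne : ((n - p * j : ℤ) : ℚ) ≠ 0 :=
        Int.cast_ne_zero.2 fun h => hd (h ▸ dvd_zero _)
      have : ((p : ℚ) ^ m)⁻¹ * F.coeff n = ((n - p * j : ℤ) : ℚ)⁻¹ * h.coeff n := by
        rw [inv_mul_eq_iff_eq_mul₀ hp0, mul_left_comm, ← hc, inv_mul_cancel_left₀ hne]
      rw [this]
      exact mul_mem (inv_intCast_mem_pIntegralSubring hd) (hh n)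
    · rw [htop, mul_zero]
      exact zero_mem _
    · rw [coeff_eq_zero_of_natDegree_lt (hdeg.trans_lt hnp), mul_zero]
      exact zero_mem _
  · rw [← C_eq_natCast, ← C_pow, ← mul_assoc, ← C_mul, mul_inv_cancel₀ hp0, C_1, one_mul]

end PrimeCongruences

/-! ### The first congruence -/

section FirstCongruence

variable {p : ℕ} [hp : Fact p.Prime]

theorem polyModEq_sum_centralBinom (hp2 : p ≠ 2) :
    PolyModEq p 3
      (∑ k ∈ Finset.range p, C ((2 * k).choose k : ℚ) * X ^ (p - 1 - k))
      (2 * lucasU (X : ℚ[X]) X p - lucasU₁ (2 - X) p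
        - 2 * (p : ℚ[X]) ^ 2 * ∑ k ∈ Finset.Icc 1 (p - 1),
            C (1 / (k : ℚ) ^ 2) * (lucasU₁ (2 - X) k + lucasU X X k)) := by
  obtain ⟨a, ha, ea⟩ := exists_sum_centralBinom_eq hp2
  obtain ⟨b, hb, eb⟩ := exists_lucasU_self_eq hp2
  obtain ⟨c, hc, ec⟩ := exists_sum_lucasU_self_div_sq_eq hp2
  have h2 : (2 : ℚ[X]) ∈ pIntegralPoly p := ofNat_mem _ 2
  refine polyModEq_of_sub_eq (h := a - 2 * b + 2 * c)
    (add_mem (sub_mem ha (mul_mem h2 hb)) (mul_mem h2 hc)) ?_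
  have e : ∑ k ∈ Finset.Icc 1 (p - 1),
      C (1 / (k : ℚ) ^ 2) * (lucasU₁ (2 - X) k + lucasU X X k) =
      lucasSum p (fun j => (j + 1 : ℚ)⁻¹ ^ 2) +
        ∑ k ∈ Finset.range (p - 1), C ((k + 1 : ℚ)⁻¹ ^ 2) * lucasU X X (k + 1) := by
    rw [sum_Icc_one_eq_sum_range, lucasSum, ← Finset.sum_add_distrib]
    refine Finset.sum_congr rfl fun k _ => ?_
    rw [one_div, inv_pow]
    push_cast
    ring
  simp only [map_natCast]
  rw [e, ec, ea, eb]
  ring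

end FirstCongruence

/-- Since `X^(p-k)` has `θ`-eigenvalue `p - k`, the operator `θ - p` removes one factor `1/k` from
the weights, up to sign. -/
theorem X_mul_derivative_sum_C_mul_X_pow (p : ℕ) (c d : ℕ → ℚ)
    (h : ∀ k ∈ Finset.Icc 1 (p - 1), k * c k = d k) :
    X * derivative (∑ k ∈ Finset.Icc 1 (p - 1), C (c k) * X ^ (p - k)) =
      (p : ℚ[X]) * ∑ k ∈ Finset.Icc 1 (p - 1), C (c k) * X ^ (p - k)
        - ∑ k ∈ Finset.Icc 1 (p - 1), C (d k) * X ^ (p - k) := by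
  rw [derivative_sum, Finset.mul_sum, Finset.mul_sum, ← Finset.sum_sub_distrib]
  refine Finset.sum_congr rfl fun k hk => ?_
  rw [← h k hk]
  rw [Finset.mem_Icc] at hk
  obtain ⟨n, rfl⟩ : ∃ n, p = k + (n + 1) := ⟨p - k - 1, by omega⟩
  rw [Nat.add_sub_cancel_left, derivative_C_mul_X_pow, Nat.add_sub_cancel, pow_succ]
  simp only [C_mul, map_natCast]
  push_cast
  ring

theorem coeff_sum_C_mul_X_pow_eq_zero (p : ℕ) (c : ℕ → ℚ) {n : ℕ} (hn : n = 0 ∨ p ≤ n) :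
    (∑ k ∈ Finset.Icc 1 (p - 1), C (c k) * X ^ (p - k)).coeff n = 0 := by
  rw [finsetSum_coeff]
  refine Finset.sum_eq_zero fun k hk => ?_
  rw [Finset.mem_Icc] at hk
  rw [coeff_C_mul_X_pow, if_neg (by omega)]

theorem natDegree_sum_C_mul_X_pow_le (p : ℕ) (c : ℕ → ℚ) :
    (∑ k ∈ Finset.Icc 1 (p - 1), C (c k) * X ^ (p - k)).natDegree ≤ p :=
  natDegree_le_iff_coeff_eq_zero.2 fun _ hn =>
    coeff_sum_C_mul_X_pow_eq_zero p c (Or.inr hn.le)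

theorem X_mul_derivative_X_pow {R : Type*} [CommRing R] :
    ∀ n : ℕ, X * derivative (X ^ n : R[X]) = (n : R[X]) * X ^ n
  | 0 => by simp
  | n + 1 => by
    rw [derivative_X_pow_succ, pow_succ, C_add, C_1, map_natCast]
    push_cast
    ring

theorem natDegree_two_sub_X_le : (2 - X : ℚ[X]).natDegree ≤ 1 :=
  (natDegree_sub_le _ _).trans (max_le (by simp) natDegree_X_le)

theorem natDegree_lucasV_two_sub_X_le (n : ℕ) : (lucasV (2 - X : ℚ[X]) 1 n).natDegree ≤ n :=
  natDegree_lucasV_le natDegree_two_sub_X_le (by simp) n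

theorem natDegree_lucasV_X_X_le (n : ℕ) : (lucasV (X : ℚ[X]) X n).natDegree ≤ n :=
  natDegree_lucasV_le natDegree_X_le natDegree_X_le n

theorem X_mul_derivative_lucasV_relation (p : ℕ) :
    X * derivative (2 * lucasV (X : ℚ[X]) X p + lucasV (2 - X) 1 p - X ^ p - 2) =
      (p : ℚ[X]) * (lucasV X X p + X * lucasU X X p - X * lucasU (2 - X) 1 p - X ^ p) := by
  have h1 := X_mul_derivative_lucasV_X_X (R := ℚ) p
  have h2 := lucasV_eq (X : ℚ[X]) X p
  have h3 := X_mul_derivative_X_pow (R := ℚ) p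
  rw [derivative_sub, derivative_sub, derivative_add, derivative_mul, derivative_ofNat,
    derivative_lucasV_two_sub_X]
  linear_combination 2 * h1 - h3 - (p : ℚ[X]) * h2

/-! ### The relation between `v_p(t, t)` and `v_p(2 - t)` modulo `p^2` -/

section PrimeCongruences

variable {p : ℕ} [hp : Fact p.Prime]

theorem coeff_two_prime : (2 : ℚ[X]).coeff p = 0 :=
  coeff_eq_zero_of_natDegree_lt ((natDegree_ofNat 2).trans_lt hp.out.pos)

theorem coeff_lucasV_X_X_prime : (lucasV (X : ℚ[X]) X p).coeff p = 1 := by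
  have := coeff_lucasV_succ (x := (X : ℚ[X])) natDegree_X_le natDegree_X_le (p - 1)
  rw [Nat.sub_add_cancel hp.out.one_le] at this
  simpa using this

theorem coeff_zero_lucasV_X_X_prime : (lucasV (X : ℚ[X]) X p).coeff 0 = 0 := by
  have := coeff_zero_lucasV_X_X (R := ℚ) (p - 1)
  rwa [Nat.sub_add_cancel hp.out.one_le] at this

theorem coeff_lucasV_two_sub_X_prime (hp2 : p ≠ 2) :
    (lucasV (2 - X : ℚ[X]) 1 p).coeff p = -1 := by
  have := coeff_lucasV_succ (x := (2 - X : ℚ[X])) (y := 1) natDegree_two_sub_X_le (by simp) (p - 1)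
  rw [Nat.sub_add_cancel hp.out.one_le] at this
  have h1 : (2 - X : ℚ[X]).coeff 1 = -1 := by simp [coeff_X, coeff_ofNat_succ]
  rw [this, h1, (hp.out.odd_of_ne_two hp2).neg_one_pow]

theorem exists_lucasV_X_X_eq_X_pow_add :
    ∃ g ∈ pIntegralPoly p, lucasV (X : ℚ[X]) X p = X ^ p + (p : ℚ[X]) * g := by
  have hp0 := hp.out.ne_zero
  have hX := X_mem_pIntegralPoly (p := p)
  obtain ⟨g, hg, e⟩ := exists_eq_pow_mul_of_X_mul_derivative (p := p) (m := 1)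
    (F := lucasV (X : ℚ[X]) X p - X ^ p) (h := lucasU X X (p + 1) - X ^ p) 0
    ⟨0, zero_mem _, by rw [coeff_sub, coeff_zero_lucasV_X_X_prime, coeff_X_pow,
      if_neg hp0.symm]; simp⟩
    ((natDegree_sub_le _ _).trans (max_le (natDegree_lucasV_X_X_le p) (natDegree_X_pow_le p)))
    (by rw [coeff_sub, coeff_lucasV_X_X_prime, coeff_X_pow_self, sub_self])
    (sub_mem (lucasU_mem hX hX _) (pow_mem hX p))
    (by
      rw [derivative_sub, mul_sub, X_mul_derivative_lucasV_X_X, X_mul_derivative_X_pow]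
      push_cast
      ring)
  exact ⟨g, hg, by rw [← pow_one (p : ℚ[X]), ← e]; ring⟩

/-- Applying `θ` gives one explicit factor `p`. The second comes from `v_p(X, X) ≡ X^p` and `u_p(X,
X) ≡ u_p(2 - X)` modulo `p`. -/
theorem exists_lucasV_relation (hp2 : p ≠ 2) :
    ∃ g ∈ pIntegralPoly p,
      2 * lucasV (X : ℚ[X]) X p + lucasV (2 - X) 1 p - X ^ p - 2 = (p : ℚ[X]) ^ 2 * g := by
  have hp0 := hp.out.ne_zero
  obtain ⟨a, ha, ea⟩ := exists_lucasV_X_X_eq_X_pow_add (p := p)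
  obtain ⟨b, hb, eb⟩ := exists_lucasU_self_eq hp2
  have hX := X_mem_pIntegralPoly (p := p)
  have hP : (p : ℚ[X]) ∈ pIntegralPoly p := natCast_mem _ p
  refine exists_eq_pow_mul_of_X_mul_derivative (p := p) 0
    (h := a + X * (lucasSum p (fun j => (j + 1 : ℚ)⁻¹)
      - (p : ℚ[X]) * lucasSum p (fun j => (j + 1 : ℚ)⁻¹ * harmonic j) + (p : ℚ[X]) ^ 2 * b))
    ⟨0, zero_mem _, ?_⟩ ?_ ?_
    (add_mem ha (mul_mem hX (add_mem (sub_mem lucasSum_inv_mem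
      (mul_mem hP lucasSum_harmonic_mem)) (mul_mem (pow_mem hP 2) hb)))) ?_
  · simp [coeff_zero_lucasV_X_X_prime, coeff_zero_lucasV_two_sub_X, coeff_X_pow, hp0.symm]
  · have := natDegree_lucasV_X_X_le p
    have := natDegree_lucasV_two_sub_X_le p
    compute_degree
    omega
  · rw [coeff_sub, coeff_sub, coeff_add, coeff_ofNat_mul, coeff_lucasV_X_X_prime,
      coeff_lucasV_two_sub_X_prime hp2, coeff_X_pow_self, coeff_two_prime]
    norm_num
  · rw [X_mul_derivative_lucasV_relation, ea, eb]
    push_cast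
    ring

end PrimeCongruences

/-! ### The second congruence -/

section SecondCongruence

variable {p : ℕ} [hp : Fact p.Prime]

theorem X_mul_sum_centralBinom :
    X * ∑ k ∈ Finset.range p, ((2 * k).choose k : ℚ[X]) * X ^ (p - 1 - k) =
      X ^ p + ∑ k ∈ Finset.Icc 1 (p - 1), C ((2 * k).choose k : ℚ) * X ^ (p - k) := by
  obtain ⟨q, rfl⟩ : ∃ q, p = q + 1 := ⟨p - 1, (Nat.sub_add_cancel hp.out.one_le).symm⟩
  rw [Finset.sum_range_succ', sum_Icc_one_eq_sum_range, mul_add, add_comm, Finset.mul_sum]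
  congr 1
  · simp [pow_succ']
  · refine Finset.sum_congr rfl fun k hk => ?_
    rw [Nat.add_sub_cancel, Finset.mem_range] at hk
    rw [show q + 1 - (k + 1) = q + 1 - 1 - (k + 1) + 1 by omega, pow_succ, map_natCast]
    ring

theorem exists_sum_centralBinom_div_eq (hp2 : p ≠ 2) :
    ∃ g ∈ pIntegralPoly p,
      ∑ k ∈ Finset.Icc 1 (p - 1), C (((2 * k).choose k : ℚ) / k) * X ^ (p - k) -
        C (1 / (p : ℚ)) * (3 * X ^ p + 2 - lucasV (2 - X) 1 p - 4 * lucasV X X p) =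
      (p : ℚ[X]) ^ 2 * g := by
  have hp0 := hp.out.ne_zero
  obtain ⟨a, ha, ea⟩ := exists_sum_centralBinom_eq hp2
  obtain ⟨b, hb, eb⟩ := exists_lucasU_self_eq hp2
  obtain ⟨w, hw, ew⟩ := exists_lucasV_relation hp2
  have hX := X_mem_pIntegralPoly (p := p)
  have hP : (p : ℚ[X]) ∈ pIntegralPoly p := natCast_mem _ p
  have h2 : (2 : ℚ[X]) ∈ pIntegralPoly p := ofNat_mem _ 2
  have hc : C (1 / (p : ℚ)) * (p : ℚ[X]) = 1 := by
    rw [← C_eq_natCast, ← C_mul, one_div_mul_cancel (Nat.cast_ne_zero.2 hp0), C_1]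
  have hs := X_mul_derivative_sum_C_mul_X_pow p (fun k => ((2 * k).choose k : ℚ) / k)
    (fun k => (2 * k).choose k) fun k hk => by
      have : (k : ℚ) ≠ 0 := Nat.cast_ne_zero.2 (by rw [Finset.mem_Icc] at hk; omega)
      field_simp
  have hS := X_mul_sum_centralBinom (p := p)
  have hv := derivative_lucasV_two_sub_X (R := ℚ) p
  have hV := X_mul_derivative_lucasV_X_X (R := ℚ) p
  have hVU := lucasV_eq (X : ℚ[X]) X p
  have hXp := X_mul_derivative_X_pow (R := ℚ) p
  -- Here `θ - p` turns the difference into `-p^2 w - X (S - 2 u_p(X, X) + u_p(2 - X))`, where `S`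
  -- is the unweighted sum; in the bracket the terms of order `p` cancel.
  refine exists_eq_pow_mul_of_X_mul_derivative (p := p) 1
    (h := -(w + X * (-2 * lucasSum p (fun j => (j + 1 : ℚ)⁻¹ * harmonic j)
      - 2 * lucasSum p (fun j => (j + 1 : ℚ)⁻¹ ^ 2) + (p : ℚ[X]) * (a - 2 * b))))
    ⟨0, zero_mem _, ?_⟩ ?_ ?_
    (neg_mem (add_mem hw (mul_mem hX (add_mem (sub_mem (mul_mem (neg_mem h2) lucasSum_harmonic_mem)
      (mul_mem h2 lucasSum_inv_sq_mem)) (mul_mem hP (sub_mem ha (mul_mem h2 hb))))))) ?_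
  · rw [coeff_sub, coeff_sum_C_mul_X_pow_eq_zero _ _ (Or.inl rfl)]
    simp [coeff_zero_lucasV_X_X_prime, coeff_zero_lucasV_two_sub_X, coeff_X_pow, hp0.symm]
  · have := natDegree_lucasV_X_X_le p
    have := natDegree_lucasV_two_sub_X_le p
    refine (natDegree_sub_le _ _).trans (max_le (natDegree_sum_C_mul_X_pow_le _ _) ?_)
    refine (natDegree_C_mul_le _ _).trans ?_
    compute_degree
    omega
  · rw [coeff_sub, coeff_sum_C_mul_X_pow_eq_zero _ _ (Or.inr le_rfl), coeff_C_mul, coeff_sub,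
      coeff_sub, coeff_add, coeff_ofNat_mul, coeff_ofNat_mul, coeff_lucasV_X_X_prime,
      coeff_lucasV_two_sub_X_prime hp2, coeff_X_pow_self, coeff_two_prime]
    norm_num
  · rw [derivative_sub, derivative_C_mul, derivative_sub, derivative_sub, derivative_add,
      derivative_mul, derivative_mul, derivative_ofNat, derivative_ofNat, derivative_ofNat, hv,
      mul_sub, hs]
    push_cast
    rw [ea] at hS
    linear_combination hS - 3 * C (1 / (p : ℚ)) * hXp + 4 * C (1 / (p : ℚ)) * hV
      + (3 * X ^ p + 2 - lucasV (2 - X) 1 p - 4 * lucasV X X p - 3 * X ^ p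
        - X * lucasU (2 - X) 1 p + 4 * lucasU X X (p + 1)) * hc - ew + 2 * X * eb - 2 * hVU

theorem polyModEq_sum_centralBinom_div (hp2 : p ≠ 2) :
    PolyModEq p 2
      (∑ k ∈ Finset.Icc 1 (p - 1), C (((2 * k).choose k : ℚ) / k) * X ^ (p - k))
      (C (1 / (p : ℚ)) * (3 * X ^ p + 2 - lucasV₁ (2 - X) p - 4 * lucasV X X p)) := by
  obtain ⟨g, hg, e⟩ := exists_sum_centralBinom_div_eq hp2
  exact polyModEq_of_sub_eq hg e

end SecondCongruence

theorem X_mul_derivative_sum_lucasV (p : ℕ) :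
    X * derivative (∑ k ∈ Finset.Icc 1 (p - 1), C (1 / (k : ℚ) ^ 2) * lucasV (2 - X) 1 k) =
      -(X * lucasSum p (fun j => (j + 1 : ℚ)⁻¹)) := by
  rw [sum_Icc_one_eq_sum_range, derivative_sum, lucasSum, ← mul_neg, ← Finset.sum_neg_distrib]
  congr 1
  refine Finset.sum_congr rfl fun k _ => ?_
  have h : C (1 / ((k + 1 : ℕ) : ℚ) ^ 2) * ((k + 1 : ℕ) : ℚ[X]) = C (k + 1 : ℚ)⁻¹ := by
    rw [← C_eq_natCast, ← C_mul]
    congr 1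
    push_cast
    field_simp
  rw [derivative_C_mul, derivative_lucasV_two_sub_X, mul_neg, ← mul_assoc, h]

/-! ### The third congruence -/

section ThirdCongruence

variable {p : ℕ} [hp : Fact p.Prime]

theorem sum_lucasV_mem :
    ∑ k ∈ Finset.Icc 1 (p - 1), C (1 / (k : ℚ) ^ 2) * lucasV (2 - X) 1 k ∈ pIntegralPoly p := by
  refine sum_mem fun k hk => mul_mem (C_mem_pIntegralPoly ?_)
    (lucasV_mem (sub_mem (ofNat_mem _ 2) X_mem_pIntegralPoly) (one_mem _) k)
  rw [Finset.mem_Icc] at hk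
  rw [one_div, ← inv_pow]
  exact pow_mem (inv_natCast_mem_pIntegralSubring
    (Nat.not_dvd_of_pos_of_lt (by omega) (by omega))) 2

/-- The criterion cannot see the constant term, which is `2 ∑ 1/k^2` because `v_k(2) = 2`. This is
where `p > 3` enters. -/
theorem exists_coeff_zero_sum_lucasV (hp3 : 3 < p) :
    ∃ r ∈ pIntegralSubring p,
      (∑ k ∈ Finset.Icc 1 (p - 1), C (1 / (k : ℚ) ^ 2) * lucasV (2 - X) 1 k).coeff 0 = p * r := by
  obtain ⟨r, hr, e⟩ := exists_sum_inv_sq_eq hp3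
  refine ⟨2 * r, mul_mem (ofNat_mem _ 2) hr, ?_⟩
  rw [finsetSum_coeff, sum_Icc_one_eq_sum_range, mul_left_comm, ← e, Finset.mul_sum]
  refine Finset.sum_congr rfl fun k _ => ?_
  rw [coeff_C_mul, coeff_zero_lucasV_two_sub_X]
  push_cast
  ring

theorem natDegree_sum_lucasV_lt :
    (∑ k ∈ Finset.Icc 1 (p - 1), C (1 / (k : ℚ) ^ 2) * lucasV (2 - X) 1 k).natDegree < p := by
  refine (natDegree_sum_le_of_forall_le (n := p - 1) _ _ fun k hk => ?_).trans_lt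
    (Nat.sub_lt hp.out.pos one_pos)
  exact (natDegree_C_mul_le _ _).trans
    ((natDegree_lucasV_two_sub_X_le k).trans (Finset.mem_Icc.1 hk).2)

theorem polyModEq_sum_centralBinom_div_sq (hp3 : 3 < p) :
    PolyModEq p 1
      (C (1 / 2 : ℚ) *
        ∑ k ∈ Finset.Icc 1 (p - 1), C (((2 * k).choose k : ℚ) / (k : ℚ) ^ 2) * X ^ (p - k))
      (C (1 / (p : ℚ) ^ 2) *
          (lucasV₁ (2 - X) p + 2 * lucasV X X p - X ^ p - 2)
        + ∑ k ∈ Finset.Icc 1 (p - 1), C (1 / (k : ℚ) ^ 2) * lucasV₁ (2 - X) k) := by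
  have hp2 : p ≠ 2 := by omega
  have hp0 := hp.out.ne_zero
  obtain ⟨a, ha, ea⟩ := exists_sum_centralBinom_div_eq hp2
  obtain ⟨b, hb, eb⟩ := exists_lucasU_self_eq hp2
  obtain ⟨w, hw, ew⟩ := exists_lucasV_relation hp2
  obtain ⟨r, hr, er⟩ := exists_coeff_zero_sum_lucasV hp3
  have hX := X_mem_pIntegralPoly (p := p)
  have hP : (p : ℚ[X]) ∈ pIntegralPoly p := natCast_mem _ p
  have h3 : (3 : ℚ[X]) ∈ pIntegralPoly p := ofNat_mem _ 3
  have hhalf : C (1 / 2 : ℚ) ∈ pIntegralPoly p := by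
    rw [one_div]
    exact C_mem_pIntegralPoly (inv_natCast_mem_pIntegralSubring (n := 2)
      (Nat.not_dvd_of_pos_of_lt two_pos (by omega)))
  have h2c : C (1 / 2 : ℚ) * 2 = 1 := by
    rw [← C_ofNat, ← C_mul]
    norm_num
  have hc : C (1 / (p : ℚ)) * (p : ℚ[X]) = 1 := by
    rw [← C_eq_natCast, ← C_mul, one_div_mul_cancel (Nat.cast_ne_zero.2 hp0), C_1]
  have hcc : C (1 / (p : ℚ) ^ 2) = C (1 / (p : ℚ)) ^ 2 := by
    rw [← C_pow, one_div_pow]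
  have hs := X_mul_derivative_sum_C_mul_X_pow p (fun k => ((2 * k).choose k : ℚ) / (k : ℚ) ^ 2)
    (fun k => ((2 * k).choose k : ℚ) / k) fun k hk => by
      have : (k : ℚ) ≠ 0 := Nat.cast_ne_zero.2 (by rw [Finset.mem_Icc] at hk; omega)
      field_simp
  have hE := X_mul_derivative_sum_lucasV p
  have hW := X_mul_derivative_lucasV_relation p
  have hE0 := natDegree_sum_lucasV_lt (p := p)
  have hEm := sum_lucasV_mem (p := p)
  set E := ∑ k ∈ Finset.Icc 1 (p - 1), C (1 / (k : ℚ) ^ 2) * lucasV (2 - X) 1 k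
  set B := ∑ k ∈ Finset.Icc 1 (p - 1), C (((2 * k).choose k : ℚ) / (k : ℚ) ^ 2) * X ^ (p - k)
    with hB
  rw [show lucasV₁ (2 - X : ℚ[X]) p + 2 * lucasV X X p - X ^ p - 2 =
    2 * lucasV (X : ℚ[X]) X p + lucasV (2 - X) 1 p - X ^ p - 2 by ring, ew]
  rw [ew] at hW
  have hcw : C (1 / (p : ℚ) ^ 2) * ((p : ℚ[X]) ^ 2 * w) = w := by
    rw [hcc]
    linear_combination (C (1 / (p : ℚ)) * (p : ℚ[X]) + 1) * w * hc
  have hwdeg : w.natDegree ≤ p := by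
    have := natDegree_lucasV_X_X_le p
    have := natDegree_lucasV_two_sub_X_le p
    rw [← hcw, ← ew]
    refine (natDegree_C_mul_le _ _).trans ?_
    compute_degree
    omega
  have hwp : w.coeff p = 0 := by
    rw [← hcw, ← ew, coeff_C_mul, coeff_sub, coeff_sub, coeff_add, coeff_ofNat_mul,
      coeff_lucasV_X_X_prime, coeff_lucasV_two_sub_X_prime hp2, coeff_X_pow_self, coeff_two_prime]
    norm_num
  have hw0 : w.coeff 0 = 0 := by
    rw [← hcw, ← ew]
    simp [coeff_zero_lucasV_X_X_prime, coeff_zero_lucasV_two_sub_X, coeff_X_pow, hp0.symm]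
  rw [hcw]
  suffices h : ∃ g ∈ pIntegralPoly p, C (1 / 2 : ℚ) * B - (w + E) = (p : ℚ[X]) ^ 1 * g by
    obtain ⟨g, hg, e⟩ := h
    exact polyModEq_of_sub_eq hg e
  -- After `θ - p`, the terms `(v_p(X, X) - X^p)/p` from `B` and `w` cancel, and `θ E` cancels the
  -- leading part `X ∑ u_{j+1}(2 - X)/(j+1)` of `θ w`. What remains is `p` times the witness `h`.
  refine exists_eq_pow_mul_of_X_mul_derivative (p := p) 1
    (h := C (1 / 2 : ℚ) * (3 * w - (p : ℚ[X]) * a) + E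
      + X * (lucasSum p (fun j => (j + 1 : ℚ)⁻¹ * harmonic j) - (p : ℚ[X]) * b))
    ⟨-r, neg_mem hr, ?_⟩ ?_ ?_
    (add_mem (add_mem (mul_mem hhalf (sub_mem (mul_mem h3 hw) (mul_mem hP ha))) hEm)
      (mul_mem hX (sub_mem lucasSum_harmonic_mem (mul_mem hP hb)))) ?_
  · rw [coeff_sub, coeff_add, coeff_C_mul, hB, coeff_sum_C_mul_X_pow_eq_zero _ _ (Or.inl rfl), er,
      hw0]
    ring
  · exact (natDegree_sub_le _ _).trans (max_le
      ((natDegree_C_mul_le _ _).trans (natDegree_sum_C_mul_X_pow_le _ _))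
      ((natDegree_add_le _ _).trans (max_le hwdeg hE0.le)))
  · rw [coeff_sub, coeff_add, coeff_C_mul, hB, coeff_sum_C_mul_X_pow_eq_zero _ _ (Or.inr le_rfl),
      hwp, coeff_eq_zero_of_natDegree_lt hE0]
    ring
  · have hP2 : (p : ℚ[X]) ^ 2 ≠ 0 := pow_ne_zero _ (Nat.cast_ne_zero.2 hp0)
    rw [← Nat.cast_pow, ← C_eq_natCast, derivative_C_mul, C_eq_natCast] at hW
    rw [← mul_right_inj' hP2, derivative_sub, derivative_add, derivative_C_mul]
    push_cast at hW ⊢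
    linear_combination (p : ℚ[X]) ^ 2 * C (1 / 2 : ℚ) * hs - (p : ℚ[X]) ^ 2 * C (1 / 2 : ℚ) * ea
      - (p : ℚ[X]) * C (1 / 2 : ℚ) * (3 * X ^ p + 2 - lucasV (2 - X) 1 p - 4 * lucasV X X p) * hc
      - hW - (p : ℚ[X]) ^ 2 * hE - (p : ℚ[X]) * X * eb
      - (p : ℚ[X]) * (1 - 3 * C (1 / 2 : ℚ)) * ew
      - (p : ℚ[X]) * (2 * lucasV X X p + lucasV (2 - X) 1 p - X ^ p - 2
        - (lucasV X X p - X ^ p)) * h2c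

end ThirdCongruence

theorem mainTheorem3 (p : ℕ) (hp : p.Prime) (hp3 : 3 < p) :
    PolyModEq p 3
      (∑ k ∈ Finset.range p, C ((2 * k).choose k : ℚ) * X ^ (p - 1 - k))
      (2 * lucasU (X : ℚ[X]) X p - lucasU₁ (2 - X) p
        - 2 * (p : ℚ[X]) ^ 2 * ∑ k ∈ Finset.Icc 1 (p - 1),
            C (1 / (k : ℚ) ^ 2) * (lucasU₁ (2 - X) k + lucasU X X k)) ∧
    PolyModEq p 2
      (∑ k ∈ Finset.Icc 1 (p - 1), C (((2 * k).choose k : ℚ) / k) * X ^ (p - k))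
      (C (1 / (p : ℚ)) *
        (3 * X ^ p + 2 - lucasV₁ (2 - X) p - 4 * lucasV X X p)) ∧
    PolyModEq p 1
      (C (1 / 2 : ℚ) *
        ∑ k ∈ Finset.Icc 1 (p - 1), C (((2 * k).choose k : ℚ) / (k : ℚ) ^ 2) * X ^ (p - k))
      (C (1 / (p : ℚ) ^ 2) *
          (lucasV₁ (2 - X) p + 2 * lucasV X X p - X ^ p - 2)
        + ∑ k ∈ Finset.Icc 1 (p - 1), C (1 / (k : ℚ) ^ 2) * lucasV₁ (2 - X) k) := by
  have : Fact p.Prime := ⟨hp⟩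
  have hp2 : p ≠ 2 := by omega
  exact ⟨polyModEq_sum_centralBinom hp2, polyModEq_sum_centralBinom_div hp2,
    polyModEq_sum_centralBinom_div_sq hp3⟩
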